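/- Let $\mathcal{H}$ be a complex Hilbert space and let $\mathcal{A}\subseteq\mathcal{L}(\mathcal{H})$ be an abelian von Neumann algebra containing the identity operator $I$ of $\mathcal{H}$. Let $\mathcal{A}_{sa}$ be its set of self-adjoint elements and $\mathcal{P}(\mathcal{A})$ its lattice of projections. Let $\mathcal{Q}(\mathcal{A})$ be the Stone spectrum of $\mathcal{A}$: the set of quasipoints, i.e. of maximal dual ideals (proper filters) of $\mathcal{P}(\mathcal{A})$, with the topology generated by the sets $\mathcal{Q}_P(\mathcal{A})=\{\beta\in\mathcal{Q}(\mathcal{A}) : P\in\beta\}$, $P\in\mathcal{P}(\mathcal{A})$. Let $\Omega(\mathcal{A})$ be the Gelfand spectrum of $\mathcal{A}$, i.e. the set of characters of $\mathcal{A}$ with the weak-* topology. Every $A\in\mathcal{A}_{sa}$ has exactly one spectral family $E^A=(E^A_\lambda)_{\lambda\in\mathbb{R}}$ in $\mathcal{P}(\mathcal{A})$, i.e. one increasing, right-continuous family of projections in $\mathcal{P}(\mathcal{A})$ that takes the values $0$ and $I$ and satisfies $A=\int\lambda\,dE^A_\lambda$ as a norm limit of Riemann–Stieltjes sums. The observable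 function of $A$ is $$f_A:\mathcal{Q}(\mathcal{A})\to\mathbb{R},\qquad f_A(\beta)=\inf\{\lambda\in\mathbb{R} : E^A_\lambda\in\beta\}.$$ There is a homeomorphism $\theta:\mathcal{Q}(\mathcal{A})\to\Omega(\mathcal{A})$, $\beta\mapsto\tau_\beta$, such that for all $\beta\in\mathcal{Q}(\mathcal{A})$ and $P\in\mathcal{P}(\mathcal{A})$ one has $\tau_\beta(P)=1$ if $P\in\beta$ and $\tau_\beta(P)=0$ if $P\notin\beta$. Every $f_A$ with $A\in\mathcal{A}_{sa}$ is continuous, the map $A\mapsto f_A$ from $\mathcal{A}_{sa}$ to $C(\mathcal{Q}(\mathcal{A}),\mathbb{R})$ is onto, and it is the restriction to $\mathcal{A}_{sa}$ of the Gelfand transformation $\Gamma:\mathcal{A}\to C(\Omega(\mathcal{A}))$, $\Gamma(A)(\tau)=\tau(A)$, after identification of $\mathcal{Q}(\mathcal{A})$ with $\Omega(\mathcal{A})$ by $\theta$: $$f_A(\beta)=\Gamma(A)(\theta(\beta))=\tau_\beta(A)\qquad\text{for all }A\in\mathcal{A}_{sa},\ \beta\in\mathcal{Q}(\mathcal{A}).$$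 -/

import Mathlib

namespace QuantumObservables

/-- A dual ideal of `L`: a proper order filter, that is, a nonempty, upward closed and downward
directed subset not containing `⊥`. If `L` is a lattice, an upward closed set is downward directed
if and only if it is closed under `⊓`. -/
def IsDualIdeal {L : Type*} [PartialOrder L] [BoundedOrder L] (J : Set L) : Prop :=
  Order.IsPFilter J ∧ ⊥ ∉ J

/-- The Stone spectrum of `L`: the set of its quasipoints, i.e. of its maximal dual ideals. -/
def StoneSpectrum (L : Type*) [PartialOrder L] [BoundedOrder L] : Type _ :=
  {β : Set L // Maximal IsDualIdeal β}

instance {L : Type*} [PartialOrder L] [BoundedOrder L] : SetLike (StoneSpectrum L) L where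
  coe β := β.1
  coe_injective := Subtype.coe_injective

/-- The topology of the Stone spectrum is generated by the sets of all quasipoints containing a
given element `a`. -/
instance {L : Type*} [PartialOrder L] [BoundedOrder L] : TopologicalSpace (StoneSpectrum L) :=
  TopologicalSpace.generateFrom (Set.range fun a : L => {β : StoneSpectrum L | a ∈ β})

/-- A bounded (right-continuous) spectral family in `L`. -/
structure BoundedSpectralFamily (L : Type*) [PartialOrder L] [BoundedOrder L] where
  toFun : ℝ → L
  monotone' : Monotone toFun
  rightContinuous' : ∀ r : ℝ, IsGLB (toFun '' Set.Ioi r) (toFun r)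
  exists_eq_bot : ∃ r, toFun r = ⊥
  exists_eq_top : ∃ r, toFun r = ⊤

instance {L : Type*} [PartialOrder L] [BoundedOrder L] :
    CoeFun (BoundedSpectralFamily L) fun _ => ℝ → L where
  coe E := E.toFun

/-- The observable function of a bounded spectral family `E` on the Stone spectrum:
`f_E(β) = inf {r | E_r ∈ β}`. -/
noncomputable def observableFunction {L : Type*} [PartialOrder L] [BoundedOrder L]
    (E : BoundedSpectralFamily L) (β : StoneSpectrum L) : ℝ :=
  sInf {r : ℝ | E r ∈ β}

/-- The set an observable function takes the infimum of is nonempty and bounded below, so that the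
infimum is a true one. -/
theorem isGLB_observableFunction {L : Type*} [PartialOrder L] [BoundedOrder L]
    (E : BoundedSpectralFamily L) (β : StoneSpectrum L) :
    IsGLB {r : ℝ | E r ∈ β} (observableFunction E β) := by
  have hβ := β.2.prop
  apply isGLB_csInf
  · obtain ⟨r, hr⟩ := E.exists_eq_top
    obtain ⟨x, hx⟩ := hβ.1.toPFilter.nonempty
    refine ⟨r, ?_⟩
    change E.toFun r ∈ hβ.1.toPFilter
    rw [hr]
    exact hβ.1.toPFilter.mem_of_le le_top hx
  · obtain ⟨r, hr⟩ := E.exists_eq_bot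
    refine ⟨r, fun s hs => ?_⟩
    by_contra! h
    have h0 : E.toFun s = ⊥ := le_bot_iff.mp (hr ▸ E.monotone' h.le)
    exact hβ.2 (h0 ▸ hs)

section VonNeumann

variable {H : Type*} [NormedAddCommGroup H] [InnerProductSpace ℂ H] [CompleteSpace H]

/-- The projections of a von Neumann algebra, ordered as operators. -/
def Projections (A : VonNeumannAlgebra H) : Type _ :=
  {p : H →L[ℂ] H // p ∈ A.toStarSubalgebra ∧ IsStarProjection p}

noncomputable instance (A : VonNeumannAlgebra H) : PartialOrder (Projections A) :=
  inferInstanceAs (PartialOrder {p : H →L[ℂ] H // p ∈ A.toStarSubalgebra ∧ IsStarProjection p})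

noncomputable instance (A : VonNeumannAlgebra H) : BoundedOrder (Projections A) where
  bot := ⟨0, zero_mem _, .zero _⟩
  bot_le p := p.2.2.nonneg
  top := ⟨1, one_mem _, .one _⟩
  le_top p := p.2.2.le_one

/-- A projection of a von Neumann algebra as an element of the algebra. -/
def Projections.toAlgebra {A : VonNeumannAlgebra H} (p : Projections A) : A.toStarSubalgebra :=
  ⟨p.1, p.2.1⟩

/-- `E` is the spectral family of `a`: `a = ∫ r dE_r`, the integral being the norm limit of the
Riemann-Stieltjes sums over partitions `t 0 ≤ ⋯ ≤ t n` with tags `s k ∈ [t k, t (k + 1)]` that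
exhaust the family. -/
def IsSpectralFamilyOf {A : VonNeumannAlgebra H} (E : BoundedSpectralFamily (Projections A))
    (a : A.toStarSubalgebra) : Prop :=
  ∀ ε > 0, ∃ δ > 0, ∀ (n : ℕ) (t s : ℕ → ℝ), E (t 0) = ⊥ → E (t n) = ⊤ →
    (∀ k < n, t k ≤ s k ∧ s k ≤ t (k + 1) ∧ t (k + 1) - t k < δ) →
    ‖a - ∑ k ∈ Finset.range n,
      (s k : ℂ) • ((E (t (k + 1))).toAlgebra - (E (t k)).toAlgebra)‖ < ε

end VonNeumann

end QuantumObservables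

/-! Gelfand duality turns the abelian algebra into the continuous functions on a compact Hausdorff
space of characters, and its projections into clopen sets (`support`). Since the algebra is its own
double commutant, the closure of every open set is such a support (`exists_support_eq_closure`), so
there are enough projections to separate characters. By compactness and maximality a quasipoint is
the filter of clopen neighbourhoods of exactly one character; this is θ (`bijective_quasipoint`).
For self-adjoint `a` with transform g, the interiors of the sets {g ≤ r} are the supports of a
spectral family of `a`. Conversely, a character turns any spectral family of `a` into a zero-one
step function jumping at the value of the observable function, so the Riemann-Stieltjes sums
approach both that value and the value of the character at `a` (`observableFunction_quasipoint`).
Thus the observable function depends on `a` only, and right-continuity recovers the family from it.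
-/

namespace QuantumObservables

variable {H : Type*} [NormedAddCommGroup H] [InnerProductSpace ℂ H] [CompleteSpace H]
  {A : VonNeumannAlgebra H}

/-! ### Gelfand theory of an abelian von Neumann algebra. -/

theorem isClosed_vonNeumannAlgebra (A : VonNeumannAlgebra H) :
    IsClosed (A.toStarSubalgebra : Set (H →L[ℂ] H)) := by
  rw [A.coe_toStarSubalgebra, ← A.centralizer_centralizer]
  exact Set.isClosed_centralizer _

theorem completeSpace_vonNeumannAlgebra (A : VonNeumannAlgebra H) :
    CompleteSpace A.toStarSubalgebra :=
  (isClosed_vonNeumannAlgebra A).completeSpace_coe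

/-- An abelian von Neumann algebra is a commutative C⋆-algebra. -/
noncomputable abbrev commCStarAlgebra (A : VonNeumannAlgebra H)
    (hA : ∀ x ∈ A, ∀ y ∈ A, x * y = y * x) : CommCStarAlgebra A.toStarSubalgebra where
  __ := completeSpace_vonNeumannAlgebra A
  __ := (inferInstance : NormedRing A.toStarSubalgebra)
  __ := (inferInstance : NormedAlgebra ℂ A.toStarSubalgebra)
  __ := (inferInstance : StarRing A.toStarSubalgebra)
  __ := (inferInstance : CStarRing A.toStarSubalgebra)
  __ := (inferInstance : StarModule ℂ A.toStarSubalgebra)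
  mul_comm x y := Subtype.ext (hA x.1 x.2 y.1 y.2)

/-- The Gelfand spectrum of a von Neumann algebra. -/
abbrev GelfandSpectrum (A : VonNeumannAlgebra H) : Type _ :=
  WeakDual.characterSpace ℂ A.toStarSubalgebra

theorem compactSpace_gelfandSpectrum (hA : ∀ x ∈ A, ∀ y ∈ A, x * y = y * x) :
    CompactSpace (GelfandSpectrum A) :=
  let := commCStarAlgebra A hA
  (inferInstance : CompactSpace (WeakDual.characterSpace ℂ A.toStarSubalgebra))

theorem exists_forall_character_eq (hA : ∀ x ∈ A, ∀ y ∈ A, x * y = y * x)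
    (g : C(GelfandSpectrum A, ℂ)) :
    ∃ a : A.toStarSubalgebra, ∀ x : GelfandSpectrum A, x a = g x := by
  let := commCStarAlgebra A hA
  obtain ⟨a, ha⟩ := (gelfandTransform_bijective A.toStarSubalgebra).2 g
  exact ⟨a, fun x => congr($ha x)⟩

theorem norm_le_of_forall_character (hA : ∀ x ∈ A, ∀ y ∈ A, x * y = y * x)
    (a : A.toStarSubalgebra) {r : ℝ} (hr : 0 ≤ r) (h : ∀ x : GelfandSpectrum A, ‖x a‖ ≤ r) :
    ‖a‖ ≤ r := by
  let := commCStarAlgebra A hA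
  have h1 : ‖WeakDual.gelfandTransform ℂ A.toStarSubalgebra a‖ = ‖a‖ :=
    (gelfandTransform_isometry A.toStarSubalgebra).norm_map_of_map_zero (map_zero _) a
  have h2 : ‖WeakDual.gelfandTransform ℂ A.toStarSubalgebra a‖ ≤ r :=
    (ContinuousMap.norm_le _ hr).2 h
  exact h1.symm.trans_le h2

theorem norm_character_le (hA : ∀ x ∈ A, ∀ y ∈ A, x * y = y * x) (x : GelfandSpectrum A)
    (a : A.toStarSubalgebra) : ‖x a‖ ≤ ‖a‖ := by
  let := commCStarAlgebra A hA
  have h1 : ‖WeakDual.gelfandTransform ℂ A.toStarSubalgebra a‖ = ‖a‖ :=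
    (gelfandTransform_isometry A.toStarSubalgebra).norm_map_of_map_zero (map_zero _) a
  have h2 : ‖WeakDual.gelfandTransform ℂ A.toStarSubalgebra a x‖ ≤
      ‖WeakDual.gelfandTransform ℂ A.toStarSubalgebra a‖ := ContinuousMap.norm_coe_le_norm _ x
  exact h2.trans_eq h1

theorem eq_of_forall_character (hA : ∀ x ∈ A, ∀ y ∈ A, x * y = y * x)
    {a b : A.toStarSubalgebra} (h : ∀ x : GelfandSpectrum A, x a = x b) : a = b := by
  have := norm_le_of_forall_character hA (a - b) le_rfl fun x => by simp [h]
  exact sub_eq_zero.1 (norm_le_zero_iff.1 this)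

theorem character_star (hA : ∀ x ∈ A, ∀ y ∈ A, x * y = y * x) (x : GelfandSpectrum A)
    (a : A.toStarSubalgebra) : x (star a) = star (x a) := by
  let := commCStarAlgebra A hA
  exact congr($(gelfandTransform_map_star a) x)

theorem continuous_character_apply (a : A.toStarSubalgebra) :
    Continuous fun x : GelfandSpectrum A => x a :=
  (WeakDual.gelfandTransform ℂ A.toStarSubalgebra a).continuous

/-! ### Projections as clopen sets of characters. -/

namespace Projections

theorem toAlgebra_mul_self (p : Projections A) : p.toAlgebra * p.toAlgebra = p.toAlgebra :=
  Subtype.ext p.2.2.isIdempotentElem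

@[simp] theorem toAlgebra_bot : (⊥ : Projections A).toAlgebra = 0 := rfl

@[simp] theorem toAlgebra_top : (⊤ : Projections A).toAlgebra = 1 := rfl

/-- The complementary projection. -/
def compl (p : Projections A) : Projections A :=
  ⟨1 - p.1, sub_mem (one_mem _) p.2.1, p.2.2.one_sub⟩

@[simp] theorem toAlgebra_compl (p : Projections A) : p.compl.toAlgebra = 1 - p.toAlgebra := rfl

/-- A projection defines a subset of the Gelfand spectrum. -/
def support (p : Projections A) : Set (GelfandSpectrum A) := {x | x p.toAlgebra = 1}

theorem mem_support {p : Projections A} {x : GelfandSpectrum A} :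
    x ∈ p.support ↔ x p.toAlgebra = 1 := Iff.rfl

theorem character_eq_zero_or_one (p : Projections A) (x : GelfandSpectrum A) :
    x p.toAlgebra = 0 ∨ x p.toAlgebra = 1 := by
  have h : x p.toAlgebra * x p.toAlgebra = x p.toAlgebra := by
    rw [← map_mul, toAlgebra_mul_self]
  exact IsIdempotentElem.iff_eq_zero_or_one.1 h

theorem character_eq_zero_iff {p : Projections A} {x : GelfandSpectrum A} :
    x p.toAlgebra = 0 ↔ x ∉ p.support := by
  rcases p.character_eq_zero_or_one x with h | h <;> simp [mem_support, h]

@[simp] theorem support_bot : (⊥ : Projections A).support = ∅ := by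
  ext x; simp [mem_support]

@[simp] theorem support_top : (⊤ : Projections A).support = Set.univ := by
  ext x; simp [mem_support]

@[simp] theorem support_compl (p : Projections A) : p.compl.support = p.supportᶜ := by
  ext x
  rw [Set.mem_compl_iff, ← character_eq_zero_iff, mem_support]
  simp

theorem isClosed_support (p : Projections A) : IsClosed p.support :=
  isClosed_singleton.preimage (continuous_character_apply p.toAlgebra)

theorem isOpen_support (p : Projections A) : IsOpen p.support := by
  rw [← isClosed_compl_iff, ← support_compl]
  exact p.compl.isClosed_support

/-- The order of projections is the identity pq = p, which can be tested on characters. This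
translates the lattice order into inclusion of clopen sets. -/
theorem support_subset_support (hA : ∀ x ∈ A, ∀ y ∈ A, x * y = y * x) {p q : Projections A} :
    p.support ⊆ q.support ↔ p ≤ q := by
  have key : p ≤ q ↔ p.toAlgebra * q.toAlgebra = p.toAlgebra :=
    (p.2.2.le_iff_mul_eq_left q.2.2).trans
      (Subtype.ext_iff (a1 := p.toAlgebra * q.toAlgebra) (a2 := p.toAlgebra)).symm
  rw [key]
  constructor
  · intro h
    refine eq_of_forall_character hA fun x => ?_
    rw [map_mul]
    rcases p.character_eq_zero_or_one x with hx | hx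
    · simp [hx]
    · rw [mem_support.1 (h hx), mul_one]
  · intro h x hx
    have := congr(x $h)
    rwa [map_mul, mem_support.1 hx, one_mul] at this

theorem support_injective (hA : ∀ x ∈ A, ∀ y ∈ A, x * y = y * x) :
    Function.Injective (support (A := A)) := fun _ _ h =>
  le_antisymm ((support_subset_support hA).1 h.le) ((support_subset_support hA).1 h.ge)

end Projections

/-! ### Extremal disconnectedness of the Gelfand spectrum. -/

theorem exists_character_eq_one_and_forall_eq_zero (hA : ∀ x ∈ A, ∀ y ∈ A, x * y = y * x)
    {F : Set (GelfandSpectrum A)} (hF : IsClosed F) {x : GelfandSpectrum A} (hx : x ∉ F) :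
    ∃ a : A.toStarSubalgebra, x a = 1 ∧ ∀ y ∈ F, y a = 0 := by
  have := compactSpace_gelfandSpectrum hA
  obtain ⟨g, h0, h1, -⟩ := exists_continuous_zero_one_of_isClosed hF
    (isClosed_singleton (x := x)) (Set.disjoint_singleton_right.2 hx)
  obtain ⟨a, ha⟩ := exists_forall_character_eq hA ⟨fun y => (g y : ℂ), by fun_prop⟩
  refine ⟨a, ?_, fun y hy => ?_⟩
  · simp [ha, h1 (Set.mem_singleton x)]
  · simp [ha, h0 hy]

/-- The closed span of the ranges of the elements of `A` whose Gelfand transforms vanish outside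
of `U`. -/
noncomputable def supportSubspace (A : VonNeumannAlgebra H) (U : Set (GelfandSpectrum A)) :
    Submodule ℂ H :=
  (Submodule.span ℂ {v | ∃ a : A.toStarSubalgebra, (∀ x ∉ U, x a = 0) ∧
    ∃ w, (a : H →L[ℂ] H) w = v}).topologicalClosure

theorem supportSubspace_le {U : Set (GelfandSpectrum A)} {K : Submodule ℂ H}
    (hK : IsClosed (K : Set H))
    (h : ∀ a : A.toStarSubalgebra, (∀ x ∉ U, x a = 0) → ∀ w, (a : H →L[ℂ] H) w ∈ K) :
    supportSubspace A U ≤ K := by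
  refine Submodule.topologicalClosure_minimal _ (Submodule.span_le.2 ?_) hK
  rintro _ ⟨a, ha, w, rfl⟩
  exact h a ha w

theorem apply_mem_supportSubspace {U : Set (GelfandSpectrum A)} {a : A.toStarSubalgebra}
    (ha : ∀ x ∉ U, x a = 0) (w : H) : (a : H →L[ℂ] H) w ∈ supportSubspace A U :=
  Submodule.le_topologicalClosure _ (Submodule.subset_span ⟨a, ha, w, rfl⟩)

instance (U : Set (GelfandSpectrum A)) : CompleteSpace (supportSubspace A U) :=
  (Submodule.isClosed_topologicalClosure _).completeSpace_coe

/-- An operator of the commutant moves past each `a`, so it preserves the span of the ranges and its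
closure; the double commutant property then puts the projection in `A`. -/
theorem starProjection_supportSubspace_mem (U : Set (GelfandSpectrum A)) :
    (supportSubspace A U).starProjection ∈ A := by
  rw [VonNeumannAlgebra.IsStarProjection.mem_iff isStarProjection_starProjection]
  intro y hy
  rw [VonNeumannAlgebra.mem_commutant_iff] at hy
  rw [Module.End.mem_invtSubmodule, Submodule.range_starProjection]
  refine supportSubspace_le (K := (supportSubspace A U).comap (y : H →ₗ[ℂ] H))
    ((Submodule.isClosed_topologicalClosure _).preimage y.continuous) fun a ha w => ?_
  have : y ((a : H →L[ℂ] H) w) = (a : H →L[ℂ] H) (y w) := congr($(hy a a.2) w).symm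
  rw [Submodule.mem_comap, ContinuousLinearMap.coe_coe, this]
  exact apply_mem_supportSubspace ha _

/-- The Gelfand spectrum of an abelian von Neumann algebra is extremally disconnected, and the
closures of its open sets come from projections of the algebra. -/
theorem exists_support_eq_closure (hA : ∀ x ∈ A, ∀ y ∈ A, x * y = y * x)
    {U : Set (GelfandSpectrum A)} (hU : IsOpen U) :
    ∃ p : Projections A, p.support = closure U := by
  let K := supportSubspace A U
  let p : Projections A :=
    ⟨K.starProjection, starProjection_supportSubspace_mem U, isStarProjection_starProjection⟩
  refine ⟨p, subset_antisymm (fun x hx => ?_) (closure_minimal (fun x hx => ?_) p.isClosed_support)⟩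
  -- A bump `b` at `x` vanishing on the closure of `U` annihilates the subspace, so `b * p = 0`,
  -- although `x` maps both factors to 1.
  · by_contra hxU
    obtain ⟨b, hb1, hb0⟩ := exists_character_eq_one_and_forall_eq_zero hA isClosed_closure hxU
    have hK : K ≤ (b : H →L[ℂ] H).ker := by
      refine supportSubspace_le (b : H →L[ℂ] H).isClosed_ker fun a ha w => ?_
      have hba : b * a = 0 := eq_of_forall_character hA fun y => by
        by_cases hy : y ∈ U
        · simp [hb0 y (subset_closure hy)]
        · simp [ha y hy]
      exact congr(($hba : H →L[ℂ] H) w)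
    have hbp : b * p.toAlgebra = 0 := by
      refine Subtype.ext (ContinuousLinearMap.ext fun w => ?_)
      exact hK (K.starProjection_apply_mem w)
    have := congr(x $hbp)
    rw [map_mul, hb1, Projections.mem_support.1 hx, map_zero] at this
    simp at this
  -- A bump `a` at `x` vanishing off `U` has its range in the subspace, so `p * a = a`.
  · obtain ⟨a, ha1, ha0⟩ := exists_character_eq_one_and_forall_eq_zero hA hU.isClosed_compl
      (Set.notMem_compl_iff.2 hx)
    have hpa : p.toAlgebra * a = a := by
      refine Subtype.ext (ContinuousLinearMap.ext fun w => ?_)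
      exact Submodule.starProjection_eq_self_iff.2 (apply_mem_supportSubspace ha0 w)
    have := congr(x $hpa)
    rwa [map_mul, ha1, mul_one] at this

theorem exists_support_eq_interior (hA : ∀ x ∈ A, ∀ y ∈ A, x * y = y * x)
    {F : Set (GelfandSpectrum A)} (hF : IsClosed F) :
    ∃ p : Projections A, p.support = interior F := by
  obtain ⟨p, hp⟩ := exists_support_eq_closure hA hF.isOpen_compl
  exact ⟨p.compl, by rw [p.support_compl, hp, closure_compl, compl_compl]⟩

theorem exists_mem_support_notMem_support (hA : ∀ x ∈ A, ∀ y ∈ A, x * y = y * x)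
    {x y : GelfandSpectrum A} (hxy : x ≠ y) :
    ∃ p : Projections A, x ∈ p.support ∧ y ∉ p.support := by
  have := compactSpace_gelfandSpectrum hA
  obtain ⟨U, V, hU, hV, hx, hy, hUV⟩ := t2_separation hxy
  obtain ⟨p, hp⟩ := exists_support_eq_closure hA hU
  refine ⟨p, hp ▸ subset_closure hx, fun h => ?_⟩
  exact (hUV.closure_left hV).notMem_of_mem_left (hp ▸ h) hy

/-! ### Quasipoints and characters. -/

theorem StoneSpectrum.isDualIdeal {L : Type*} [PartialOrder L] [BoundedOrder L]
    (β : StoneSpectrum L) : IsDualIdeal (β : Set L) := β.2.prop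

open Projections

theorem isDualIdeal_setOf_mem_support (hA : ∀ x ∈ A, ∀ y ∈ A, x * y = y * x)
    (x : GelfandSpectrum A) : IsDualIdeal {p : Projections A | x ∈ p.support} := by
  refine ⟨Order.IsPFilter.of_def ⟨⊤, by simp⟩ ?_ ?_, by simp⟩
  · intro p hp q hq
    obtain ⟨r, hr⟩ := exists_support_eq_closure hA (p.isOpen_support.inter q.isOpen_support)
    rw [(p.isClosed_support.inter q.isClosed_support).closure_eq] at hr
    refine ⟨r, hr.ge ⟨hp, hq⟩, ?_, ?_⟩
    · exact (support_subset_support hA).1 (hr.le.trans Set.inter_subset_left)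
    · exact (support_subset_support hA).1 (hr.le.trans Set.inter_subset_right)
  · intro p q hpq hp
    exact (support_subset_support hA).2 hpq hp

/-- A dual ideal with a further projection would contain it together with its complement, hence also
⊥. -/
theorem maximal_setOf_mem_support (hA : ∀ x ∈ A, ∀ y ∈ A, x * y = y * x)
    (x : GelfandSpectrum A) : Maximal IsDualIdeal {p : Projections A | x ∈ p.support} := by
  refine ⟨isDualIdeal_setOf_mem_support hA x, fun J hJ hxJ p hp => ?_⟩
  by_contra hx
  have hc : p.compl ∈ J := hxJ (by simpa using hx)
  obtain ⟨q, hq, hqp, hqc⟩ := hJ.1.toPFilter.directed p hp p.compl hc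
  have h1 := (support_subset_support hA).2 hqp
  have h2 := (support_subset_support hA).2 hqc
  rw [support_compl] at h2
  have : q = ⊥ := support_injective hA (by
    rw [support_bot, Set.eq_empty_iff_forall_notMem]
    exact fun y hy => h2 hy (h1 hy))
  exact hJ.2 (this ▸ hq)

/-- The quasipoint of all projections at which a character takes the value one. -/
def quasipoint (hA : ∀ x ∈ A, ∀ y ∈ A, x * y = y * x) (x : GelfandSpectrum A) :
    StoneSpectrum (Projections A) :=
  ⟨{p | x ∈ p.support}, maximal_setOf_mem_support hA x⟩

theorem mem_quasipoint (hA : ∀ x ∈ A, ∀ y ∈ A, x * y = y * x) {x : GelfandSpectrum A}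
    {p : Projections A} : p ∈ quasipoint hA x ↔ x ∈ p.support := Iff.rfl

theorem continuous_quasipoint (hA : ∀ x ∈ A, ∀ y ∈ A, x * y = y * x) :
    Continuous (quasipoint hA) := by
  refine continuous_generateFrom_iff.2 ?_
  rintro _ ⟨p, rfl⟩
  exact p.isOpen_support

theorem bijective_quasipoint (hA : ∀ x ∈ A, ∀ y ∈ A, x * y = y * x) :
    Function.Bijective (quasipoint hA) := by
  constructor
  · intro x y h
    by_contra hxy
    obtain ⟨p, hx, hy⟩ := exists_mem_support_notMem_support hA hxy
    exact hy ((mem_quasipoint hA).1 (h ▸ (mem_quasipoint hA).2 hx))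
  · intro β
    have := compactSpace_gelfandSpectrum hA
    have hβ := β.isDualIdeal
    have : Nonempty (β : Set (Projections A)) := hβ.1.toPFilter.nonempty.to_subtype
    -- The supports of members of `β` are nonempty, compact and directed, so they share a character;
    -- maximality of `β` upgrades the resulting inclusion to equality.
    obtain ⟨x, hx⟩ := IsCompact.nonempty_iInter_of_directed_nonempty_isCompact_isClosed
      (fun p : (β : Set (Projections A)) => p.1.support)
      (fun p q => by
        obtain ⟨r, hr, hrp, hrq⟩ := hβ.1.toPFilter.directed p.1 p.2 q.1 q.2
        exact ⟨⟨r, hr⟩, (support_subset_support hA).2 hrp, (support_subset_support hA).2 hrq⟩)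
      (fun p => by
        rw [Set.nonempty_iff_ne_empty, ← support_bot]
        intro h
        exact hβ.2 (support_injective hA h ▸ p.2))
      (fun p => p.1.isClosed_support.isCompact) (fun p => p.1.isClosed_support)
    refine ⟨x, Subtype.ext (β.2.eq_of_subset (isDualIdeal_setOf_mem_support hA x) ?_).symm⟩
    exact fun p hp => Set.mem_iInter.1 hx ⟨p, hp⟩

theorem t2Space_stoneSpectrum (hA : ∀ x ∈ A, ∀ y ∈ A, x * y = y * x) :
    T2Space (StoneSpectrum (Projections A)) := by
  refine ⟨fun β γ h => ?_⟩
  obtain ⟨x, rfl⟩ := (bijective_quasipoint hA).2 β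
  obtain ⟨y, rfl⟩ := (bijective_quasipoint hA).2 γ
  obtain ⟨p, hx, hy⟩ := exists_mem_support_notMem_support hA (ne_of_apply_ne _ h)
  refine ⟨{β | p ∈ β}, {β | p.compl ∈ β}, .basic _ ⟨p, rfl⟩, .basic _ ⟨p.compl, rfl⟩, hx,
    (mem_quasipoint hA).2 (by simpa using hy), Set.disjoint_left.2 fun β hp hc => ?_⟩
  obtain ⟨z, rfl⟩ := (bijective_quasipoint hA).2 β
  rw [Set.mem_ofPred_eq, mem_quasipoint, support_compl] at hc
  exact hc hp

/-- The Stone spectrum of an abelian von Neumann algebra is homeomorphic to its Gelfand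
spectrum. -/
noncomputable def stoneGelfandHomeomorph (hA : ∀ x ∈ A, ∀ y ∈ A, x * y = y * x) :
    StoneSpectrum (Projections A) ≃ₜ GelfandSpectrum A :=
  have := compactSpace_gelfandSpectrum hA
  have := t2Space_stoneSpectrum hA
  (Continuous.homeoOfEquivCompactToT2 (f := Equiv.ofBijective _ (bijective_quasipoint hA))
    (continuous_quasipoint hA)).symm

theorem mem_iff_stoneGelfandHomeomorph_mem_support (hA : ∀ x ∈ A, ∀ y ∈ A, x * y = y * x)
    (β : StoneSpectrum (Projections A)) (p : Projections A) :
    p ∈ β ↔ stoneGelfandHomeomorph hA β ∈ p.support := by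
  obtain ⟨x, rfl⟩ := (stoneGelfandHomeomorph hA).symm.surjective β
  rw [Homeomorph.apply_symm_apply]
  exact mem_quasipoint hA

/-! ### Spectral families and observable functions. -/

/-- A Riemann-Stieltjes sum with respect to a zero-one valued step function is close to the
position of the step. -/
theorem norm_sub_sum_mul_le {n : ℕ} {u : ℕ → ℂ} {s : ℕ → ℝ} {c δ : ℝ}
    (h0 : u 0 = 0) (hn : u n = 1)
    (hu : ∀ k < n, u (k + 1) = u k ∨ u k = 0 ∧ u (k + 1) = 1 ∧ |c - s k| ≤ δ) :
    ‖(c : ℂ) - ∑ k ∈ Finset.range n, (s k : ℂ) * (u (k + 1) - u k)‖ ≤ δ := by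
  have h1 : ∑ k ∈ Finset.range n, (u (k + 1) - u k) = 1 := by
    rw [Finset.sum_range_sub, h0, hn, sub_zero]
  have h2 : (c : ℂ) - ∑ k ∈ Finset.range n, (s k : ℂ) * (u (k + 1) - u k) =
      ∑ k ∈ Finset.range n, ((c - s k : ℝ) : ℂ) * (u (k + 1) - u k) := by
    simp only [Complex.ofReal_sub, sub_mul, Finset.sum_sub_distrib, ← Finset.mul_sum]
    simp only [← Finset.sum_sub_distrib, h1, mul_one]
  -- The increments sum to 1, so `δ` is a sum over the same partition and the bound can be checked
  -- term by term.
  have h3 : ((δ : ℝ) : ℂ) = ∑ k ∈ Finset.range n, (δ : ℂ) * (u (k + 1) - u k) := by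
    rw [← Finset.mul_sum, h1, mul_one]
  have h4 : δ = ∑ k ∈ Finset.range n, δ * (u (k + 1) - u k).re := by
    simpa using congr(Complex.re $h3)
  rw [h2]
  refine (norm_sum_le _ _).trans (le_of_le_of_eq (Finset.sum_le_sum fun k hk => ?_) h4.symm)
  rcases hu k (Finset.mem_range.1 hk) with h | ⟨h, h', h''⟩
  · simp [h]
  · rw [norm_mul, Complex.norm_real, Real.norm_eq_abs]
    simpa [h, h'] using h''

theorem character_sub_sum (x : GelfandSpectrum A) (a : A.toStarSubalgebra) (n : ℕ) (t s : ℕ → ℝ)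
    (E : ℝ → Projections A) :
    x (a - ∑ k ∈ Finset.range n,
      (s k : ℂ) • ((E (t (k + 1))).toAlgebra - (E (t k)).toAlgebra)) =
    x a - ∑ k ∈ Finset.range n,
      (s k : ℂ) * (x (E (t (k + 1))).toAlgebra - x (E (t k)).toAlgebra) := by
  rw [map_sub, map_sum]
  simp only [map_smul, map_sub, smul_eq_mul]

/-- The real values of the Gelfand transform of `a`. -/
noncomputable def gelfandRe (a : A.toStarSubalgebra) (x : GelfandSpectrum A) : ℝ := (x a).re

theorem continuous_gelfandRe (a : A.toStarSubalgebra) : Continuous (gelfandRe a) :=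
  Complex.continuous_re.comp (continuous_character_apply a)

theorem ofReal_gelfandRe (hA : ∀ x ∈ A, ∀ y ∈ A, x * y = y * x)
    {a : A.toStarSubalgebra} (ha : IsSelfAdjoint a) (x : GelfandSpectrum A) :
    (gelfandRe a x : ℂ) = x a :=
  Complex.conj_eq_iff_re.1 (by
    have := character_star hA x a
    rw [ha.star_eq] at this
    exact this.symm)

/-- The set {f ≤ r} is closed but perhaps not open; its interior is a support. Right-continuity
holds because an open set inside {f ≤ s} for all s > r lies in the interior of {f ≤ r}. -/
theorem exists_boundedSpectralFamily (hA : ∀ x ∈ A, ∀ y ∈ A, x * y = y * x)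
    {f : GelfandSpectrum A → ℝ} (hf : Continuous f) :
    ∃ E : BoundedSpectralFamily (Projections A),
      ∀ r, (E r).support = interior {x | f x ≤ r} := by
  have := compactSpace_gelfandSpectrum hA
  choose E hE using fun r : ℝ =>
    exists_support_eq_interior hA (isClosed_le hf (continuous_const (y := r)))
  obtain ⟨m, hm⟩ := (isCompact_range hf).bddBelow
  obtain ⟨M, hM⟩ := (isCompact_range hf).bddAbove
  have hmono : Monotone E := fun r s hrs => (support_subset_support hA).1 (by
    rw [hE, hE]
    exact interior_mono fun x hx => le_trans hx hrs)
  -- The set {f ≤ m} may have interior points if `m` is attained, hence `m - 1`.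
  refine ⟨⟨E, hmono, fun r => ⟨?_, fun q hq => ?_⟩, ⟨m - 1, ?_⟩, ⟨M, ?_⟩⟩, hE⟩
  · rintro _ ⟨s, hs, rfl⟩
    exact hmono (le_of_lt hs)
  · refine (support_subset_support hA).1 ?_
    rw [hE]
    refine interior_maximal (fun x hx => ?_) q.isOpen_support
    change f x ≤ r
    refine le_of_forall_gt_imp_ge_of_dense fun s hs => ?_
    have h := (support_subset_support hA).2 (hq ⟨s, hs, rfl⟩) hx
    rw [hE] at h
    exact (interior_subset h : _)
  · refine support_injective hA ?_
    rw [hE, support_bot, ← Set.subset_empty_iff]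
    refine interior_subset.trans fun x hx => ?_
    have := hm ⟨x, rfl⟩
    simp only [Set.mem_ofPred_eq] at hx
    linarith
  · refine support_injective hA ?_
    rw [hE, support_top, show {x | f x ≤ M} = Set.univ from
      Set.eq_univ_of_forall fun x => hM ⟨x, rfl⟩, interior_univ]

theorem le_of_notMem_interior_setOf_le {X : Type*} [TopologicalSpace X] {f : X → ℝ}
    (hf : Continuous f) {r : ℝ} {x : X} (hx : x ∉ interior {x | f x ≤ r}) : r ≤ f x := by
  by_contra! h
  exact hx (interior_maximal (fun y hy => le_of_lt hy) (isOpen_lt hf continuous_const) h)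

theorem isSpectralFamilyOf_of_support_eq (hA : ∀ x ∈ A, ∀ y ∈ A, x * y = y * x)
    {a : A.toStarSubalgebra} (ha : IsSelfAdjoint a) {E : BoundedSpectralFamily (Projections A)}
    (hE : ∀ r, (E r).support = interior {x | gelfandRe a x ≤ r}) : IsSpectralFamilyOf E a := by
  intro ε hε
  -- The error at each character is at most the mesh bound; halving turns the non-strict norm bound
  -- into a strict one.
  refine ⟨ε / 2, half_pos hε, fun n t s h0 hn hts => ?_⟩
  refine lt_of_le_of_lt (norm_le_of_forall_character hA _ (half_pos hε).le fun x => ?_)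
    (half_lt_self hε)
  rw [character_sub_sum, ← ofReal_gelfandRe hA ha]
  refine norm_sub_sum_mul_le (u := fun k => x (E (t k)).toAlgebra) (by simp [h0]) (by simp [hn])
    fun k hk => ?_
  obtain ⟨h1, h2, h3⟩ := hts k hk
  by_cases hx : x ∈ (E (t k)).support
  · left
    have hx' := (support_subset_support hA).2 (E.monotone' (h1.trans h2)) hx
    exact (mem_support.1 hx').trans (mem_support.1 hx).symm
  by_cases hx' : x ∈ (E (t (k + 1))).support
  · refine .inr ⟨character_eq_zero_iff.2 hx, hx', ?_⟩
    rw [hE] at hx hx'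
    have h4 := le_of_notMem_interior_setOf_le (continuous_gelfandRe a) hx
    have h5 : gelfandRe a x ≤ t (k + 1) := (interior_subset hx' : _)
    rw [abs_le]
    constructor <;> linarith
  · left
    exact (character_eq_zero_iff.2 hx').trans (character_eq_zero_iff.2 hx).symm

theorem observableFunction_quasipoint (hA : ∀ x ∈ A, ∀ y ∈ A, x * y = y * x)
    {a : A.toStarSubalgebra} {E : BoundedSpectralFamily (Projections A)}
    (hE : IsSpectralFamilyOf E a) (β : StoneSpectrum (Projections A)) :
    (observableFunction E β : ℂ) = stoneGelfandHomeomorph hA β a := by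
  set x := stoneGelfandHomeomorph hA β
  have hglb := isGLB_observableFunction E β
  set c := observableFunction E β
  have hmem (r : ℝ) : E r ∈ β ↔ x ∈ (E r).support :=
    mem_iff_stoneGelfandHomeomorph_mem_support hA β (E r)
  refine eq_of_forall_dist_le fun ε hε => ?_
  obtain ⟨δ, hδ, h⟩ := hE (ε / 2) (half_pos hε)
  obtain ⟨m, hm⟩ := E.exists_eq_bot
  obtain ⟨M, hM⟩ := E.exists_eq_top
  -- The step `η` is below `δ` to make the partition admissible, and below `ε / 2` so that the two
  -- errors add up to at most `ε`.
  obtain ⟨η, hη, hηmin⟩ := exists_between (lt_min hδ (half_pos hε))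
  obtain ⟨hηδ, hηε⟩ := lt_min_iff.1 hηmin
  obtain ⟨n, hn⟩ := Archimedean.arch (M - m) hη
  rw [nsmul_eq_mul] at hn
  let t : ℕ → ℝ := fun k => m + k * η
  have htsucc (k : ℕ) : t (k + 1) = t k + η := by simp only [t]; push_cast; ring
  have h0 : E (t 0) = ⊥ := by simpa [t] using hm
  have h1 : E (t n) = ⊤ := top_le_iff.1 (hM ▸ E.monotone' (by simp only [t]; linarith))
  have h2 := h n t t h0 h1 fun k _ => by
    rw [htsucc]; exact ⟨le_rfl, by linarith, by linarith⟩
  have h3 := (norm_character_le hA x _).trans h2.le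
  rw [character_sub_sum, ← dist_eq_norm] at h3
  have h4 := norm_sub_sum_mul_le (u := fun k => x (E (t k)).toAlgebra) (s := t) (n := n) (c := c)
    (δ := η) (by simp [h0]) (by simp [h1]) fun k _ => by
      by_cases hk : x ∈ (E (t k)).support
      · left
        have hk' := (support_subset_support hA).2
          (E.monotone' (show t k ≤ t (k + 1) by rw [htsucc]; linarith)) hk
        exact (mem_support.1 hk').trans (mem_support.1 hk).symm
      by_cases hk' : x ∈ (E (t (k + 1))).support
      · refine .inr ⟨character_eq_zero_iff.2 hk, hk', ?_⟩
        have h5 : c ≤ t (k + 1) := hglb.1 ((hmem _).2 hk')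
        have h6 : t k ≤ c := hglb.2 fun r hr => by
          by_contra! hlt
          exact hk ((support_subset_support hA).2 (E.monotone' hlt.le) ((hmem _).1 hr))
        rw [htsucc] at h5
        rw [abs_le]
        constructor <;> linarith
      · left
        exact (character_eq_zero_iff.2 hk').trans (character_eq_zero_iff.2 hk).symm
  rw [← dist_eq_norm] at h4
  have h5 := dist_triangle_right (c : ℂ) (x a) _ |>.trans (add_le_add h4 h3)
  linarith

theorem IsSpectralFamilyOf.le (hA : ∀ x ∈ A, ∀ y ∈ A, x * y = y * x)
    {a : A.toStarSubalgebra} {E F : BoundedSpectralFamily (Projections A)}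
    (hE : IsSpectralFamilyOf E a) (hF : IsSpectralFamilyOf F a) (r : ℝ) : E r ≤ F r := by
  -- The infimum defining the observable function need not be attained, so `E r` is compared with `F
  -- s` for `s > r` only.
  refine (F.rightContinuous' r).2 ?_
  rintro _ ⟨s, hs, rfl⟩
  refine (support_subset_support hA).1 fun x hx => ?_
  obtain ⟨β, rfl⟩ := (stoneGelfandHomeomorph hA).surjective x
  rw [← mem_iff_stoneGelfandHomeomorph_mem_support] at hx ⊢
  have h : observableFunction E β = observableFunction F β := Complex.ofReal_injective <| by
    rw [observableFunction_quasipoint hA hE, observableFunction_quasipoint hA hF]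
  have h1 := (isGLB_observableFunction E β).1 hx
  obtain ⟨q, hq, hqs⟩ := (isGLB_lt_iff (isGLB_observableFunction F β)).1
    (lt_of_le_of_lt (h ▸ h1) hs)
  exact β.isDualIdeal.1.toPFilter.mem_of_le (F.monotone' hqs.le) hq

end QuantumObservables

/-! ### Assembly of the theorem. -/

theorem mainTheorem6 {H : Type*} [NormedAddCommGroup H] [InnerProductSpace ℂ H] [CompleteSpace H]
    (A : VonNeumannAlgebra H) (hA : ∀ x ∈ A, ∀ y ∈ A, x * y = y * x) :
    -- every self-adjoint element has exactly one spectral family in the projection lattice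
    (∀ a : selfAdjoint A.toStarSubalgebra,
      ∃! E : QuantumObservables.BoundedSpectralFamily (QuantumObservables.Projections A),
        QuantumObservables.IsSpectralFamilyOf E a.1) ∧
    -- the identification of the Stone spectrum with the Gelfand spectrum
    ∃ θ : QuantumObservables.StoneSpectrum (QuantumObservables.Projections A) ≃ₜ
        WeakDual.characterSpace ℂ A.toStarSubalgebra,
      (∀ (β : QuantumObservables.StoneSpectrum (QuantumObservables.Projections A))
        (p : QuantumObservables.Projections A),
        (p ∈ β → θ β p.toAlgebra = 1) ∧ (p ∉ β → θ β p.toAlgebra = 0)) ∧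
      -- `f` is the map sending `a` to its observable function
      ∃ f : selfAdjoint A.toStarSubalgebra →
          C(QuantumObservables.StoneSpectrum (QuantumObservables.Projections A), ℝ),
        (∀ (a : selfAdjoint A.toStarSubalgebra)
          (E : QuantumObservables.BoundedSpectralFamily (QuantumObservables.Projections A)),
          QuantumObservables.IsSpectralFamilyOf E a.1 →
            ∀ β, f a β = QuantumObservables.observableFunction E β) ∧
        Function.Surjective f ∧
        ∀ (a : selfAdjoint A.toStarSubalgebra)
          (β : QuantumObservables.StoneSpectrum (QuantumObservables.Projections A)),
          ((f a β : ℝ) : ℂ) = WeakDual.gelfandTransform ℂ A.toStarSubalgebra a.1 (θ β) := by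
  open QuantumObservables in
  -- The map `f` is defined through the Gelfand transform, which makes continuity immediate;
  -- agreement with the observable functions is then proved.
  refine ⟨fun a => ?_, stoneGelfandHomeomorph hA, fun β p => ?_, fun a =>
    ⟨fun β => gelfandRe a.1 (stoneGelfandHomeomorph hA β),
      (continuous_gelfandRe a.1).comp (stoneGelfandHomeomorph hA).continuous⟩,
    fun a E hE β => ?_, fun g => ?_, fun a β => ofReal_gelfandRe hA a.2 _⟩
  · obtain ⟨E, hE⟩ := exists_boundedSpectralFamily hA (continuous_gelfandRe a.1)
    have hEa := isSpectralFamilyOf_of_support_eq hA a.2 hE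
    refine ⟨E, hEa, fun F hF => ?_⟩
    have : F.toFun = E.toFun := funext fun r => le_antisymm (hF.le hA hEa r) (hEa.le hA hF r)
    cases F
    cases E
    congr
  · rw [mem_iff_stoneGelfandHomeomorph_mem_support hA, ← Projections.character_eq_zero_iff]
    exact ⟨id, id⟩
  · apply Complex.ofReal_injective
    rw [observableFunction_quasipoint hA hE]
    exact ofReal_gelfandRe hA a.2 _
  · obtain ⟨a, ha⟩ := exists_forall_character_eq hA
      ⟨fun x => (g ((stoneGelfandHomeomorph hA).symm x) : ℂ), by fun_prop⟩
    have hsa : IsSelfAdjoint a := eq_of_forall_character hA fun x => by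
      rw [character_star hA, ha]
      exact Complex.conj_ofReal _
    refine ⟨⟨a, hsa⟩, ContinuousMap.ext fun β => ?_⟩
    simp [gelfandRe, ha]
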